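/- Let $R$ be a commutative Gorenstein ring (that is, $R$ is noetherian and for every prime ideal $\mathfrak{p}$ the local ring $R_{\mathfrak{p}}$ has finite injective dimension as a module over itself) of finite Krull dimension $d \ge 0$; $R$ need not be local. Let $M$ be a finitely generated $R$-module such that (i) $\operatorname{Ext}^i_R(M,M)=0$ for all integers $i$ with $0<i<d$ (an empty condition if $d\le 1$), and (ii) $\operatorname{Hom}_R(M,M)$ is a projective $R$-module. Then $M$ is a projective $R$-module. -/

import Mathlib

universe u

/-- A Gorenstein local ring: a noetherian local ring of finite injective dimension as a module
over itself. -/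
structure IsGorensteinLocalRing (A : Type u) [CommRing A] : Prop where
  isLocalRing : IsLocalRing A
  isNoetherianRing : IsNoetherianRing A
  finite_injectiveDimension :
    ∃ n : ℕ, CategoryTheory.HasInjectiveDimensionLE (ModuleCat.of A A) n

/-- A Gorenstein ring: a noetherian commutative ring all of whose localizations at prime ideals
are Gorenstein local rings. No bound on the Krull dimension is imposed. -/
structure IsGorensteinRing (R : Type u) [CommRing R] : Prop where
  isNoetherianRing : IsNoetherianRing R
  isGorensteinLocalRing_localization :
    ∀ (p : Ideal R) [p.IsPrime], IsGorensteinLocalRing (Localization.AtPrime p)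

/-! Projectivity is checked at maximal ideals, so `R` may be taken local of finite injective
dimension with `End(M)` free. Induction on the rank of `End(M)` then reduces everything to splitting
a copy of `R` off a nonzero `M` (`exists_surjective_to_ring`).

For this, extend a sequence regular on both `R` and `M`, generating `I`, until the residue field `k`
embeds in `R/I` (`exists_regularIdeal_endReduction`). Vanishing of `Ext^i(M, M)` makes `End(M)/I
End(M) → Hom(M, M/IM)` bijective before length `d` and still injective at length `d`; freeness of
`End(M)` thus transfers regularity from `R/I` to `M/IM`.

Since `R/I` has projective dimension at most the length `s`, the embedding of `k` forces `Ext^i(C,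
R) = 0` for finite `C` and `i > s`. Hence `Ext^i(M, R) = 0` for `i > 0`, and `R/I` splits off any
finite module killed by `I` that contains it. A basis of `End(M)` shows that `M/IM` is faithful over
`R/I`, so `R/I` is a summand of a power of `M/IM`. The components of the retraction lift to maps `M
→ R`, one of which is surjective. -/

open CategoryTheory Abelian IsLocalRing Pointwise

/-! ### Vanishing of Ext along short exact sequences and retracts -/

section ExtVanishing

variable {C : Type*} [Category C] [Abelian C] [HasExt C]
  {S : ShortComplex C} (hS : S.ShortExact)

include hS

lemma ext_subsingleton_covariant_X₃ (X : C) (n : ℕ) (h₂ : Subsingleton (Ext X S.X₂ n))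
    (h₁ : Subsingleton (Ext X S.X₁ (n + 1))) : Subsingleton (Ext X S.X₃ n) :=
  subsingleton_of_forall_eq 0 fun e ↦ by
    obtain ⟨e', rfl⟩ := Ext.covariant_sequence_exact₃ X hS e rfl (Subsingleton.elim _ _)
    rw [Subsingleton.elim e' 0, Ext.zero_comp]

lemma ext_subsingleton_contravariant_X₂ (Y : C) (n : ℕ) (h₁ : Subsingleton (Ext S.X₁ Y n))
    (h₃ : Subsingleton (Ext S.X₃ Y n)) : Subsingleton (Ext S.X₂ Y n) :=
  subsingleton_of_forall_eq 0 fun e ↦ by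
    obtain ⟨e', rfl⟩ := Ext.contravariant_sequence_exact₂ hS Y e (Subsingleton.elim _ _)
    rw [Subsingleton.elim e' 0, Ext.comp_zero]

lemma ext_subsingleton_contravariant_X₁ (Y : C) (n : ℕ) (h₂ : Subsingleton (Ext S.X₂ Y n))
    (h₃ : Subsingleton (Ext S.X₃ Y (n + 1))) : Subsingleton (Ext S.X₁ Y n) :=
  subsingleton_of_forall_eq 0 fun e ↦ by
    obtain ⟨e', rfl⟩ := Ext.contravariant_sequence_exact₁ hS Y e (add_comm 1 n)
      (Subsingleton.elim _ _)
    rw [Subsingleton.elim e' 0, Ext.comp_zero]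

lemma ext_subsingleton_contravariant_X₃ (Y : C) (n : ℕ) (h₂ : Subsingleton (Ext S.X₂ Y (n + 1)))
    (h₁ : Subsingleton (Ext S.X₁ Y n)) : Subsingleton (Ext S.X₃ Y (n + 1)) :=
  subsingleton_of_forall_eq 0 fun e ↦ by
    obtain ⟨e', rfl⟩ := Ext.contravariant_sequence_exact₃ hS Y e (Subsingleton.elim _ _)
      (add_comm 1 n)
    rw [Subsingleton.elim e' 0, Ext.comp_zero]

omit hS in
lemma ext_subsingleton_of_retract {X Y X' Y' : C} (iX : X' ⟶ X) (pX : X ⟶ X')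
    (iY : Y' ⟶ Y) (pY : Y ⟶ Y') (hX : iX ≫ pX = 𝟙 X') (hY : iY ≫ pY = 𝟙 Y') (n : ℕ)
    (h : Subsingleton (Ext X Y n)) : Subsingleton (Ext X' Y' n) :=
  subsingleton_of_forall_eq 0 fun e ↦ by
    have key : ((Ext.mk₀ pX).comp e (zero_add n)).comp (Ext.mk₀ iY) (add_zero n) = 0 :=
      Subsingleton.elim _ _
    have := congrArg (fun t ↦ (Ext.mk₀ iX).comp (t.comp (Ext.mk₀ pY) (add_zero n)) (zero_add n)) key
    simpa [Ext.comp_assoc_of_third_deg_zero, hX, hY] using this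

end ExtVanishing

/-! ### Ext of modules, and quotients by one more element -/

section ModuleExt

variable {R : Type u} [CommRing R]

/-- Nakayama, since Ext between finite modules is finite. -/
lemma ext_subsingleton_of_surjective_smul [IsNoetherianRing R] [IsLocalRing R]
    (X Y : ModuleCat.{u} R) [Module.Finite R X] [Module.Finite R Y] (n : ℕ) {x : R}
    (hx : x ∈ maximalIdeal R) (h : ∀ e : Ext X Y n, ∃ e', x • e' = e) :
    Subsingleton (Ext X Y n) := by
  have : (⊤ : Submodule R (Ext X Y n)) = ⊥ := by
    refine Submodule.eq_bot_of_le_smul_of_le_jacobson_bot (Ideal.span {x}) ⊤ Module.Finite.fg_top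
      (fun e _ ↦ ?_) ?_
    · obtain ⟨e', rfl⟩ := h e
      exact Submodule.smul_mem_smul (Ideal.mem_span_singleton_self x) trivial
    · rw [IsLocalRing.jacobson_eq_maximalIdeal ⊥ bot_ne_top, Ideal.span_singleton_le_iff_mem]
      exact hx
  exact (Submodule.subsingleton_iff R).1 (subsingleton_of_bot_eq_top this.symm)

lemma mk₀_smul_id_comp {X Y : ModuleCat.{u} R} (n : ℕ) (e : Ext X Y n) (x : R) :
    (Ext.mk₀ (x • 𝟙 X)).comp e (zero_add n) = x • e := by
  simp [Ext.mk₀_smul]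

lemma comp_mk₀_smul_id {X Y : ModuleCat.{u} R} (n : ℕ) (e : Ext X Y n) (x : R) :
    e.comp (Ext.mk₀ (x • 𝟙 Y)) (add_zero n) = x • e := by
  simp [Ext.mk₀_smul]

lemma ext_smul_eq_zero_of_annihilates {X Y : ModuleCat.{u} R} (n : ℕ) (e : Ext X Y n) {x : R}
    (hx : ∀ m : X, x • m = 0) : x • e = 0 := by
  have : x • 𝟙 X = 0 := by
    exact ModuleCat.hom_ext (LinearMap.ext hx)
  rw [← mk₀_smul_id_comp, this, Ext.mk₀_zero, Ext.zero_comp]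

variable (R) in
lemma ext_subsingleton_of_linearEquiv {X Y X' Y' : Type u} [AddCommGroup X] [Module R X]
    [AddCommGroup Y] [Module R Y] [AddCommGroup X'] [Module R X'] [AddCommGroup Y'] [Module R Y']
    (eX : X ≃ₗ[R] X') (eY : Y ≃ₗ[R] Y') (n : ℕ)
    (h : Subsingleton (Ext (ModuleCat.of R X) (ModuleCat.of R Y) n)) :
    Subsingleton (Ext (ModuleCat.of R X') (ModuleCat.of R Y') n) :=
  ext_subsingleton_of_retract eX.toModuleIso.inv eX.toModuleIso.hom eY.toModuleIso.inv
    eY.toModuleIso.hom eX.toModuleIso.inv_hom_id eY.toModuleIso.inv_hom_id n h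

variable (X : Type u) [AddCommGroup X] [Module R X]

/-- The quotient `X / I X`. -/
abbrev ModIdeal (I : Ideal R) : Type u := X ⧸ (I • ⊤ : Submodule R X)

/-- The projection `X / I X → X / (I + (x)) X`. -/
def modIdealProj (I : Ideal R) (x : R) : ModIdeal X I →ₗ[R] ModIdeal X (I ⊔ Ideal.span {x}) :=
  Submodule.factor (Submodule.smul_mono_left (le_sup_left : I ≤ I ⊔ Ideal.span {x}))

lemma modIdealProj_surjective (I : Ideal R) (x : R) :
    Function.Surjective (modIdealProj X I x) :=
  Submodule.factor_surjective (Submodule.smul_mono_left le_sup_left)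

lemma modIdealProj_exact (I : Ideal R) (x : R) :
    Function.Exact (LinearMap.lsmul R (ModIdeal X I) x) (modIdealProj X I x) := by
  intro y
  obtain ⟨y, rfl⟩ := Submodule.mkQ_surjective _ y
  have h : modIdealProj X I x (Submodule.mkQ _ y) = 0 ↔
      y ∈ (I • ⊤ ⊔ Ideal.span {x} • ⊤ : Submodule R X) := by
    rw [← Submodule.sup_smul, ← Submodule.Quotient.mk_eq_zero]
    rfl
  rw [h, Submodule.ideal_span_singleton_smul, Submodule.mem_sup]
  constructor
  · rintro ⟨a, ha, b, hb, rfl⟩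
    obtain ⟨b, -, rfl⟩ := Submodule.mem_smul_pointwise_iff_exists _ _ _ |>.1 hb
    refine ⟨Submodule.mkQ _ b, ?_⟩
    rw [LinearMap.lsmul_apply, ← map_smul, ← sub_eq_zero, ← map_sub, Submodule.mkQ_apply,
      Submodule.Quotient.mk_eq_zero]
    simpa using ha
  · rintro ⟨z, hz⟩
    obtain ⟨z, rfl⟩ := Submodule.mkQ_surjective _ z
    refine ⟨y - x • z, ?_, x • z, Submodule.smul_mem_pointwise_smul _ _ _ trivial, by abel⟩
    rw [← Submodule.Quotient.mk_eq_zero, ← Submodule.mkQ_apply, map_sub, map_smul, ← hz,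
      LinearMap.lsmul_apply, sub_self]

/-- The complex `0 → X / I X → X / I X → X / (I + (x)) X → 0`. -/
abbrev modIdealShortComplex (I : Ideal R) (x : R) : ShortComplex (ModuleCat.{u} R) :=
  ModuleCat.shortComplexOfCompEqZero (LinearMap.lsmul R (ModIdeal X I) x) (modIdealProj X I x)
    (modIdealProj_exact X I x).linearMap_comp_eq_zero

lemma modIdealShortComplex_shortExact {I : Ideal R} {x : R} (hx : IsSMulRegular (ModIdeal X I) x) :
    (modIdealShortComplex X I x).ShortExact :=
  ModuleCat.shortComplex_shortExact _ (modIdealProj_exact X I x) hx (modIdealProj_surjective X I x)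

end ModuleExt

/-! ### Ext and regular sequences -/

section RegularIdeal

variable {R : Type u} [CommRing R] [IsLocalRing R]

/-- `RegularIdeal X s I` means that `I` is generated by a sequence of length `s` in the maximal
ideal that is weakly regular both on `R` and on `X`. -/
inductive RegularIdeal (X : Type u) [AddCommGroup X] [Module R X] : ℕ → Ideal R → Prop
  | bot : RegularIdeal X 0 ⊥
  | sup {s : ℕ} {I : Ideal R} {x : R} (h : RegularIdeal X s I) (mem : x ∈ maximalIdeal R)
      (reg_ring : IsSMulRegular (ModIdeal R I) x) (reg_module : IsSMulRegular (ModIdeal X I) x) :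
      RegularIdeal X (s + 1) (I ⊔ Ideal.span {x})

variable {X : Type u} [AddCommGroup X] [Module R X]

lemma RegularIdeal.le_maximalIdeal {s : ℕ} {I : Ideal R} (h : RegularIdeal X s I) :
    I ≤ maximalIdeal R := by
  induction h with
  | bot => exact bot_le
  | sup h mem _ _ ih => exact sup_le ih ((Ideal.span_singleton_le_iff_mem _).2 mem)

omit [IsLocalRing R] in
variable (R X) in
/-- The quotient of `X` by `0 X` is `X`. -/
noncomputable def modIdealBotEquiv : ModIdeal X (⊥ : Ideal R) ≃ₗ[R] X :=
  Submodule.quotEquivOfEqBot _ (by simp)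

/-- Each regular element raises the projective dimension of the quotient of `R` by at most one. -/
lemma RegularIdeal.ext_subsingleton_modIdeal_ring {s : ℕ} {I : Ideal R} (h : RegularIdeal X s I)
    (Y : ModuleCat.{u} R) (i : ℕ) (hi : s < i) :
    Subsingleton (Ext (ModuleCat.of R (ModIdeal R I)) Y i) := by
  induction h generalizing i with
  | bot =>
    have : Subsingleton (Ext (ModuleCat.of R R) Y i) := by
      obtain ⟨i, rfl⟩ := Nat.exists_eq_succ_of_ne_zero hi.ne'
      exact Ext.subsingleton_of_projective _ _ _
    exact ext_subsingleton_of_linearEquiv R (modIdealBotEquiv R R).symm (LinearEquiv.refl R Y) i this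
  | @sup s I x h mem hR hX ih =>
    obtain ⟨i, rfl⟩ := Nat.exists_eq_succ_of_ne_zero (Nat.ne_zero_of_lt hi)
    exact ext_subsingleton_contravariant_X₃ (modIdealShortComplex_shortExact R hR) Y i
      (ih _ (by lia)) (ih _ (by lia))

/-- Vanishing of `Ext^(j+1)` on the quotient by `x` makes `x` act surjectively on `Ext^j`, which is
then zero by Nakayama; each element removed lowers the bound by one. -/
lemma RegularIdeal.ext_subsingleton_of_modIdeal_module [IsNoetherianRing R] [Module.Finite R X]
    {s : ℕ} {I : Ideal R} (h : RegularIdeal X s I) (Y : ModuleCat.{u} R) [Module.Finite R Y]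
    (hY : ∀ i, s < i → Subsingleton (Ext (ModuleCat.of R (ModIdeal X I)) Y i)) (i : ℕ)
    (hi : 0 < i) : Subsingleton (Ext (ModuleCat.of R X) Y i) := by
  induction h with
  | bot =>
    exact ext_subsingleton_of_linearEquiv R (modIdealBotEquiv R X) (LinearEquiv.refl R Y) i
      (hY i hi)
  | @sup s I x h mem hR hX ih =>
    refine ih fun j hj ↦ ext_subsingleton_of_surjective_smul _ _ j mem fun e ↦ ?_
    have := hY (j + 1) (by lia)
    obtain ⟨e', he'⟩ := Ext.contravariant_sequence_exact₁ (modIdealShortComplex_shortExact X hX) Y e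
      (add_comm 1 j) (Subsingleton.elim (α := Ext (ModuleCat.of R (ModIdeal X _)) Y (j + 1)) _ _)
    exact ⟨e', (mk₀_smul_id_comp (X := ModuleCat.of R (ModIdeal X I)) j e' x).symm.trans he'⟩

lemma RegularIdeal.ext_subsingleton_into_modIdeal_ring {s : ℕ} {I : Ideal R}
    (h : RegularIdeal X s I) (Z : ModuleCat.{u} R)
    (hZ : ∀ i, 0 < i → Subsingleton (Ext Z (ModuleCat.of R R) i)) (i : ℕ) (hi : 0 < i) :
    Subsingleton (Ext Z (ModuleCat.of R (ModIdeal R I)) i) := by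
  induction h generalizing i with
  | bot =>
    exact ext_subsingleton_of_linearEquiv R (LinearEquiv.refl R Z) (modIdealBotEquiv R R).symm i
      (hZ i hi)
  | sup h mem hR hX ih =>
    exact ext_subsingleton_covariant_X₃ (modIdealShortComplex_shortExact R hR) Z i
      (ih _ hi) (ih _ (by lia))

omit [IsLocalRing R] in
lemma exists_lift_modIdealProj {I : Ideal R} {x : R} (hx : IsSMulRegular (ModIdeal X I) x)
    {Z : Type u} [AddCommGroup Z] [Module R Z]
    (hZ : Subsingleton (Ext (ModuleCat.of R Z) (ModuleCat.of R (ModIdeal X I)) 1))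
    (g : Z →ₗ[R] ModIdeal X (I ⊔ Ideal.span {x})) :
    ∃ g' : Z →ₗ[R] ModIdeal X I, modIdealProj X I x ∘ₗ g' = g := by
  obtain ⟨e, he⟩ := Ext.covariant_sequence_exact₃ (ModuleCat.of R Z)
    (modIdealShortComplex_shortExact X hx)
    (Ext.mk₀ (ModuleCat.ofHom g : ModuleCat.of R Z ⟶ (modIdealShortComplex X I x).X₃))
    (zero_add 1) (Subsingleton.elim (α := Ext (ModuleCat.of R Z)
      (ModuleCat.of R (ModIdeal X I)) 1) _ _)
  obtain ⟨g', rfl⟩ := Ext.mk₀_bijective _ _ |>.2 e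
  rw [Ext.mk₀_comp_mk₀] at he
  exact ⟨g'.hom, congrArg ModuleCat.Hom.hom ((Ext.mk₀_bijective _ _).1 he)⟩

omit [IsLocalRing R] in
lemma modIdealProj_mk (I : Ideal R) (x : R) (y : X) :
    modIdealProj X I x (Submodule.Quotient.mk y) = Submodule.Quotient.mk y := rfl

/-- The obstruction to undoing one quotient step lies in `Ext^1` into the previous quotient of `R`.
-/
lemma RegularIdeal.exists_lift_to_ring {s : ℕ} {I : Ideal R}
    (h : RegularIdeal X s I) {Z : Type u} [AddCommGroup Z] [Module R Z]
    (hZ : ∀ i, 0 < i → Subsingleton (Ext (ModuleCat.of R Z) (ModuleCat.of R R) i))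
    (g : Z →ₗ[R] ModIdeal R I) : ∃ G : Z →ₗ[R] R, ∀ z, Submodule.Quotient.mk (G z) = g z := by
  induction h with
  | bot =>
    exact ⟨modIdealBotEquiv R R ∘ₗ g, fun z ↦ (modIdealBotEquiv R R).symm_apply_apply _⟩
  | @sup s I x h mem hR hX ih =>
    obtain ⟨g', rfl⟩ := exists_lift_modIdealProj hR
      (h.ext_subsingleton_into_modIdeal_ring _ hZ 1 one_pos) g
    obtain ⟨G, hG⟩ := ih g'
    refine ⟨G, fun z ↦ ?_⟩
    rw [LinearMap.comp_apply, ← hG, modIdealProj_mk]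

lemma RegularIdeal.ext_ring_subsingleton_of_lt {s : ℕ} {I : Ideal R} (h : RegularIdeal X s I)
    {Z : Type u} [AddCommGroup Z] [Module R Z] (hZ : ∀ r ∈ I, ∀ z : Z, r • z = 0)
    (i : ℕ) (hi : i < s) : Subsingleton (Ext (ModuleCat.of R Z) (ModuleCat.of R R) i) := by
  -- Each element removed from the sequence lengthens the range of vanishing by one, so the range
  -- over `R/I` must be arbitrary for the induction.
  suffices H : ∀ t, (∀ i < t, Subsingleton (Ext (ModuleCat.of R Z) (ModuleCat.of R (ModIdeal R I)) i))
      → ∀ i < t + s, Subsingleton (Ext (ModuleCat.of R Z) (ModuleCat.of R R) i) from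
    H 0 (by simp) i (by simpa using hi)
  clear hi i
  induction h with
  | bot =>
    exact fun t ht i hi ↦ ext_subsingleton_of_linearEquiv R (LinearEquiv.refl R Z)
      (modIdealBotEquiv R R) i (ht i hi)
  | @sup s I x h mem hR hX ih =>
    intro t ht i hi
    have hxZ : ∀ z : Z, x • z = 0 :=
      hZ x (Ideal.mem_sup_right (Ideal.mem_span_singleton_self x))
    refine ih (fun r hr ↦ hZ r (Ideal.mem_sup_left hr)) (t + 1) (fun j hj ↦ ?_) i (by lia)
    cases j with
    | zero =>
      have : Subsingleton (Z →ₗ[R] ModIdeal R I) :=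
        hR.linearMap_subsingleton_of_mem_annihilator (Module.mem_annihilator.2 hxZ)
      exact (Ext.addEquiv₀.trans ModuleCat.homAddEquiv).subsingleton
    | succ j =>
      refine subsingleton_of_forall_eq 0 fun e ↦ ?_
      obtain ⟨e', rfl⟩ := Ext.covariant_sequence_exact₁ _ (modIdealShortComplex_shortExact R hR) e
        ((comp_mk₀_smul_id (Y := ModuleCat.of R (ModIdeal R I)) _ e x).trans
          (ext_smul_eq_zero_of_annihilates _ _ hxZ)) rfl
      have := ht j (by lia)
      rw [Subsingleton.elim (α := Ext (ModuleCat.of R Z) (ModuleCat.of R (ModIdeal R _)) j) e' 0,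
        Ext.zero_comp]

/-- A substitute for the change of rings `Ext^(t+s)(-, R) ≅ Ext^t(-, R/I)`, carrying only
surjectivity of precomposition. The case `t = 0` extends homomorphisms into `R/I`. -/
lemma RegularIdeal.precomp_modIdeal_ring_surjective {s : ℕ} {I : Ideal R}
    (h : RegularIdeal X s I) {P P' : ModuleCat.{u} R} (f : P' ⟶ P)
    (hP : ∀ r ∈ I, ∀ z : P, r • z = 0) (hP' : ∀ r ∈ I, ∀ z : P', r • z = 0) (t : ℕ)
    (hv : ∀ i < t + s, Subsingleton (Ext P' (ModuleCat.of R R) i))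
    (hs : ∀ e : Ext P' (ModuleCat.of R R) (t + s), ∃ e' : Ext P (ModuleCat.of R R) (t + s),
      (Ext.mk₀ f).comp e' (zero_add _) = e) :
    (∀ i < t, Subsingleton (Ext P' (ModuleCat.of R (ModIdeal R I)) i)) ∧
    ∀ e : Ext P' (ModuleCat.of R (ModIdeal R I)) t,
      ∃ e' : Ext P (ModuleCat.of R (ModIdeal R I)) t, (Ext.mk₀ f).comp e' (zero_add _) = e := by
  induction h generalizing t with
  | bot =>
    refine ⟨fun i hi ↦ ext_subsingleton_of_linearEquiv R (LinearEquiv.refl R P')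
      (modIdealBotEquiv R R).symm i (hv i hi), fun e ↦ ?_⟩
    let φ := (modIdealBotEquiv R R).toModuleIso
    obtain ⟨e', he'⟩ := hs (e.comp (Ext.mk₀ φ.hom) (add_zero t))
    refine ⟨e'.comp (Ext.mk₀ φ.inv) (add_zero t), ?_⟩
    rw [← Ext.comp_assoc_of_third_deg_zero]
    erw [he']
    rw [Ext.comp_assoc_of_third_deg_zero, Ext.mk₀_comp_mk₀, φ.hom_inv_id, Ext.comp_mk₀_id]
  | @sup s I x h mem hR hX ih =>
    have hxP : ∀ z : P, x • z = 0 :=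
      hP x (Ideal.mem_sup_right (Ideal.mem_span_singleton_self x))
    have hts : t + (s + 1) = t + 1 + s := by lia
    rw [hts] at hv hs
    obtain ⟨hv', hs'⟩ := ih (fun r hr ↦ hP r (Ideal.mem_sup_left hr))
      (fun r hr ↦ hP' r (Ideal.mem_sup_left hr)) (t + 1) hv hs
    have hS := modIdealShortComplex_shortExact R hR
    refine ⟨fun i hi ↦ ext_subsingleton_covariant_X₃ hS _ i (hv' i (by lia))
      (hv' (i + 1) (by lia)), fun (e : Ext P' (modIdealShortComplex R I x).X₃ t) ↦ ?_⟩
    -- The connecting image of `e` lifts along `f` to `w`; as `x` kills `P`, `w` is itself a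
    -- connecting image, of `e'`. The error between `e` and the pullback of `e'` comes from a
    -- vanishing group.
    obtain ⟨w, hw⟩ := hs' (e.comp hS.extClass rfl)
    obtain ⟨e', rfl⟩ := Ext.covariant_sequence_exact₁ _ hS w
        ((comp_mk₀_smul_id (Y := ModuleCat.of R (ModIdeal R I)) _ w x).trans
          (ext_smul_eq_zero_of_annihilates _ _ hxP)) rfl
    obtain ⟨v, hv⟩ := Ext.covariant_sequence_exact₃ _ hS
      ((Ext.mk₀ f).comp e' (zero_add _) - e) rfl (by
        rw [sub_eq_add_neg, Ext.add_comp, Ext.neg_comp, ← hw, ← sub_eq_add_neg, sub_eq_zero]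
        exact Ext.comp_assoc _ _ _ _ _ (by lia))
    have := hv' t (by lia)
    rw [Subsingleton.elim (α := Ext P' (ModuleCat.of R (ModIdeal R I)) t) v 0, Ext.zero_comp] at hv
    exact ⟨e', sub_eq_zero.1 hv.symm⟩

end RegularIdeal

/-! ### Bounding the injective dimension -/

section InjectiveDimension

variable {R : Type u} [CommRing R] [IsLocalRing R] [IsNoetherianRing R]

/-- By prime filtrations, only `R/p` matters. If `p` is not maximal, some `y` in the maximal ideal
is regular on `R/p`, and vanishing one degree up makes `y` act surjectively on `Ext^n`. -/
lemma ext_subsingleton_of_residueField (Y : ModuleCat.{u} R) [Module.Finite R Y] (n : ℕ)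
    (hsucc : ∀ (C : Type u) [AddCommGroup C] [Module R C] [Module.Finite R C],
      Subsingleton (Ext (ModuleCat.of R C) Y (n + 1)))
    (hk : Subsingleton (Ext (ModuleCat.of R (R ⧸ maximalIdeal R)) Y n))
    (C : Type u) [AddCommGroup C] [Module R C] [hC : Module.Finite R C] :
    Subsingleton (Ext (ModuleCat.of R C) Y n) := by
  induction hC using IsNoetherianRing.induction_on_isQuotientEquivQuotientPrime R with
  | subsingleton N =>
    exact subsingleton_of_forall_eq 0 fun e ↦ by
      rw [← Ext.mk₀_id_comp e, (ModuleCat.isZero_of_subsingleton (ModuleCat.of R N)).eq_of_src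
        (𝟙 _) 0, Ext.mk₀_zero, Ext.zero_comp]
  | quotient N p f =>
    rcases eq_or_ne p.1 (maximalIdeal R) with hp | hp
    · rw [hp] at f
      exact ext_subsingleton_of_linearEquiv R f.symm (LinearEquiv.refl R Y) n hk
    · obtain ⟨y, hy, hyp⟩ := SetLike.exists_of_lt (lt_of_le_of_ne (le_maximalIdeal p.2.ne_top) hp)
      have hreg : IsSMulRegular (R ⧸ p.1) y := by
        rw [isSMulRegular_iff_right_eq_zero_of_smul]
        intro a ha
        rw [Algebra.smul_def, mul_eq_zero] at ha
        exact ha.resolve_left fun h ↦ hyp (Ideal.Quotient.eq_zero_iff_mem.1 h)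
      have hregN : IsSMulRegular (ModuleCat.of R N) y := (f.isSMulRegular_congr y).2 hreg
      refine ext_subsingleton_of_surjective_smul _ _ n hy fun e ↦ ?_
      have := hsucc (QuotSMulTop y N)
      obtain ⟨e', he'⟩ := Ext.contravariant_sequence_exact₁ hregN.smulShortComplex_shortExact Y e
        (add_comm 1 n) (Subsingleton.elim (α := Ext (ModuleCat.of R (QuotSMulTop y N)) Y (n + 1))
          _ _)
      exact ⟨e', (mk₀_smul_id_comp (X := ModuleCat.of R N) n e' y).symm.trans he'⟩
  | exact N₁ N₂ N₃ f g hf hg hfg h₁ h₃ =>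
    exact ext_subsingleton_contravariant_X₂
      (ModuleCat.shortComplex_shortExact (ModuleCat.shortComplexOfCompEqZero f g
        hfg.linearMap_comp_eq_zero) hfg hf hg) Y n h₁ h₃

/-- Descending induction from the given bound `n`: with `k` embedded in `R/I`, `Ext^i(k, Y)` sits
between `Ext^i(R/I, Y)`, zero for `i > s`, and an `Ext^(i+1)` already known to vanish. -/
lemma ext_subsingleton_of_lt_of_residueField_hom {X : Type u} [AddCommGroup X] [Module R X]
    {s : ℕ} {I : Ideal R} (h : RegularIdeal X s I)
    (φ : (R ⧸ maximalIdeal R) →ₗ[R] ModIdeal R I) (hφ : φ ≠ 0)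
    (Y : ModuleCat.{u} R) [Module.Finite R Y] (n : ℕ) (hn : HasInjectiveDimensionLE Y n)
    (i : ℕ) (hi : s < i) (C : Type u) [AddCommGroup C] [Module R C] [Module.Finite R C] :
    Subsingleton (Ext (ModuleCat.of R C) Y i) := by
  suffices H : ∀ j i, n < i + j → s < i → ∀ (C : Type u) [AddCommGroup C] [Module R C]
      [Module.Finite R C], Subsingleton (Ext (ModuleCat.of R C) Y i) from
    H (n + 1) i (by lia) hi C
  intro j
  induction j with
  | zero =>
    intro i hni _ C _ _ _
    exact HasInjectiveDimensionLT.subsingleton Y (n + 1) i (by lia) _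
  | succ j ih =>
    intro i hni hsi C _ _ _
    refine ext_subsingleton_of_residueField Y i (ih (i + 1) (by lia) (by lia)) ?_ C
    have : IsSimpleModule R (R ⧸ maximalIdeal R) :=
      isSimpleModule_iff_isCoatom.2 (maximalIdeal.isMaximal R).out
    exact ext_subsingleton_contravariant_X₁
      (ModuleCat.shortComplex_shortExact (ModuleCat.shortComplexOfCompEqZero φ φ.range.mkQ
        φ.exact_map_mkQ_range.linearMap_comp_eq_zero) φ.exact_map_mkQ_range
        (LinearMap.injective_of_ne_zero hφ) (Submodule.mkQ_surjective _)) Y i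
      (h.ext_subsingleton_modIdeal_ring Y i hsi) (ih (i + 1) (by lia) (by lia) _)

end InjectiveDimension

/-! ### Coordinates of elements of `I H` -/

section EndBasis

variable {R : Type*} [CommRing R] {H ι : Type*} [AddCommGroup H] [Module R H]
  (b : Module.Basis ι R H)

include b in
lemma mem_ideal_smul_top_iff_repr (I : Ideal R) (h : H) :
    h ∈ (I • ⊤ : Submodule R H) ↔ ∀ i, b.repr h i ∈ I := by
  constructor
  · intro hh i
    induction hh using Submodule.smul_induction_on' with
    | smul r hr n hn => simpa using I.mul_mem_right _ hr
    | add x hx y hy hx' hy' => simpa using I.add_mem hx' hy'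
  · intro hh
    rw [← b.linearCombination_repr h, Finsupp.linearCombination_apply]
    exact Submodule.sum_mem _ fun i _ ↦ Submodule.smul_mem_smul (hh i) trivial

end EndBasis

/-! ### Building a sequence regular on both `R` and `M` -/

section Tower

variable {R : Type u} [CommRing R] [IsLocalRing R] (M : Type u) [AddCommGroup M] [Module R M]

/-- The properties of `M / I M` that survive along a regular sequence when `Ext^i(M, M) = 0` for
`0 < i < d`: the dimension drops, the groups `Ext^i(M, M / I M)` vanish in a shrinking range, and
`Hom(M, M) / I Hom(M, M) → Hom(M, M / I M)` stays injective, and bijective if the length is less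
than `d`. -/
structure EndReduction (d s : ℕ) (I : Ideal R) : Prop where
  dim : ringKrullDim (R ⧸ I) + s ≤ d
  ext_subsingleton : ∀ i, 0 < i → i + s < d →
    Subsingleton (Ext (ModuleCat.of R M) (ModuleCat.of R (ModIdeal M I)) i)
  mem_of_forall_mem : ∀ g : M →ₗ[R] M, (∀ m, g m ∈ (I • ⊤ : Submodule R M)) →
    g ∈ (I • ⊤ : Submodule R (M →ₗ[R] M))
  exists_lift : s < d → ∀ h : M →ₗ[R] ModIdeal M I,
    ∃ g : M →ₗ[R] M, ∀ m, Submodule.Quotient.mk (g m) = h m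

variable {M}

omit [IsLocalRing R] in
lemma endReduction_bot {d : ℕ} (hd : ringKrullDim R ≤ d)
    (hExt : ∀ i, 0 < i → i < d → Subsingleton (Ext (ModuleCat.of R M) (ModuleCat.of R M) i)) :
    EndReduction M d 0 (⊥ : Ideal R) where
  dim := by
    rw [ringKrullDim_eq_of_ringEquiv (RingEquiv.quotientBot R)]
    simpa using hd
  ext_subsingleton i hi hid := ext_subsingleton_of_linearEquiv R (LinearEquiv.refl R M)
    (modIdealBotEquiv R M).symm i (hExt i hi hid)
  mem_of_forall_mem g hg := by
    have : g = 0 := LinearMap.ext fun m ↦ by simpa using hg m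
    rw [this]
    exact zero_mem _
  exists_lift _ h := ⟨modIdealBotEquiv R M ∘ₗ h, fun m ↦
    (modIdealBotEquiv R M).symm_apply_apply _⟩

omit [IsLocalRing R] in
lemma ringKrullDim_quotient_sup_span_add_one_le {I : Ideal R} {x : R}
    (hx : IsSMulRegular (ModIdeal R I) x) :
    ringKrullDim (R ⧸ (I ⊔ Ideal.span {x})) + 1 ≤ ringKrullDim (R ⧸ I) := by
  have hI : (I • ⊤ : Submodule R R) = I := by simp
  have hx' : IsSMulRegular (R ⧸ I) x :=
    ((Submodule.quotEquivOfEq _ _ hI).isSMulRegular_congr x).1 hx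
  refine ringKrullDim_succ_le_of_surjective (Ideal.Quotient.factor le_sup_left)
    (Ideal.Quotient.factor_surjective le_sup_left) (r := Ideal.Quotient.mk I x) ?_ ?_
  · rw [mem_nonZeroDivisors_iff_right]
    intro z hz
    refine hx'.right_eq_zero_of_smul ?_
    rwa [Algebra.smul_def, mul_comm]
  · exact Ideal.Quotient.eq_zero_iff_mem.2 (Ideal.mem_sup_right (Ideal.mem_span_singleton_self x))

lemma EndReduction.lt_of_isSMulRegular {d s : ℕ} {I : Ideal R} (h : EndReduction M d s I)
    (hI : I ≤ maximalIdeal R) {x : R} (hx : x ∈ maximalIdeal R)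
    (hreg : IsSMulRegular (ModIdeal R I) x) : s < d := by
  have hne : I ⊔ Ideal.span {x} ≠ ⊤ := fun h ↦ (maximalIdeal.isMaximal R).ne_top
    (top_le_iff.1 (h ▸ sup_le hI ((Ideal.span_singleton_le_iff_mem _).2 hx)))
  have := Ideal.Quotient.nontrivial_iff.2 hne
  have h0 : 0 ≤ ringKrullDim (R ⧸ (I ⊔ Ideal.span {x})) := ringKrullDim_nonneg_of_nontrivial
  have h1 : (1 : WithBot ℕ∞) + s ≤ d := by
    refine le_trans ?_ h.dim
    gcongr
    exact le_trans (by simpa using add_le_add_left h0 1)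
      (ringKrullDim_quotient_sup_span_add_one_le hreg)
  have h2 : 1 + s ≤ d := by exact_mod_cast h1
  lia

omit [IsLocalRing R] in
lemma EndReduction.sup {d s : ℕ} {I : Ideal R} (h : EndReduction M d s I) (hsd : s < d) {x : R}
    (hreg : IsSMulRegular (ModIdeal R I) x) (hregM : IsSMulRegular (ModIdeal M I) x) :
    EndReduction M d (s + 1) (I ⊔ Ideal.span {x}) where
  dim := by
    refine le_trans ?_ h.dim
    rw [Nat.cast_add, Nat.cast_one, add_comm (s : WithBot ℕ∞), ← add_assoc]
    gcongr
    exact ringKrullDim_quotient_sup_span_add_one_le hreg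
  ext_subsingleton i hi hid :=
    ext_subsingleton_covariant_X₃ (modIdealShortComplex_shortExact M hregM) _ i
      (h.ext_subsingleton i hi (by lia)) (h.ext_subsingleton (i + 1) (by lia) (by lia))
  mem_of_forall_mem g hg := by
    have hex := modIdealProj_exact M I x
    let k : M →ₗ[R] ModIdeal M I := Submodule.mkQ _ ∘ₗ g
    have hk : ∀ m, ∃ y : ModIdeal M I, x • y = k m := fun m ↦ by
      obtain ⟨y, hy⟩ := (hex (k m)).1 ((Submodule.Quotient.mk_eq_zero _).2 (hg m))
      exact ⟨y, hy⟩
    choose f hf using hk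
    let f' : M →ₗ[R] ModIdeal M I :=
      { toFun := f
        map_add' a b := hregM (by simp only [smul_add, hf, map_add])
        map_smul' r a := hregM (by simp only [hf, map_smul, RingHom.id_apply, smul_comm x r]) }
    -- Modulo `I`, `g` is `x` times a map into `M/IM`; lifting that map to `End(M)` needs `s < d`.
    obtain ⟨f'', hf''⟩ := h.exists_lift hsd f'
    have hmem := h.mem_of_forall_mem (g - x • f'') fun m ↦ by
      rw [← Submodule.Quotient.mk_eq_zero]
      change Submodule.Quotient.mk (g m - x • f'' m) = _
      rw [Submodule.Quotient.mk_sub, Submodule.Quotient.mk_smul, hf'' m, sub_eq_zero]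
      exact (hf m).symm
    rw [← sub_add_cancel g (x • f'')]
    exact add_mem (Submodule.smul_mono_left le_sup_left hmem) (Submodule.smul_mem_smul
      (Ideal.mem_sup_right (Ideal.mem_span_singleton_self x)) trivial)
  exists_lift hsd' g := by
    -- The needed `Ext^1(M, M/IM) = 0` requires `1 + s < d`, so lifting is lost once the length
    -- reaches `d`.
    obtain ⟨g', rfl⟩ := exists_lift_modIdealProj hregM
      (h.ext_subsingleton 1 one_pos (by lia)) g
    obtain ⟨G, hG⟩ := h.exists_lift hsd g'
    refine ⟨G, fun m ↦ ?_⟩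
    rw [LinearMap.comp_apply, ← hG, modIdealProj_mk]

omit [IsLocalRing R] in
/-- If `Hom(M, M)` is free and nonzero, an element regular on `R / I` is regular on
`Hom(M, M / I M)`. -/
lemma EndReduction.eq_zero_of_smul_eq_zero {d s : ℕ} {I : Ideal R} (h : EndReduction M d s I)
    (hsd : s < d) [Module.Free R (M →ₗ[R] M)] {x : R} (hreg : IsSMulRegular (ModIdeal R I) x)
    (f : M →ₗ[R] ModIdeal M I) (hf : x • f = 0) : f = 0 := by
  let b := Module.Free.chooseBasis R (M →ₗ[R] M)
  obtain ⟨g, hg⟩ := h.exists_lift hsd f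
  have hmem := h.mem_of_forall_mem (x • g) fun m ↦ by
    rw [← Submodule.Quotient.mk_eq_zero, LinearMap.smul_apply, Submodule.Quotient.mk_smul, hg,
      ← LinearMap.smul_apply, hf, LinearMap.zero_apply]
  rw [mem_ideal_smul_top_iff_repr b] at hmem
  have hmem' : g ∈ (I • ⊤ : Submodule R (M →ₗ[R] M)) := by
    rw [mem_ideal_smul_top_iff_repr b]
    intro i
    have hI : (I • ⊤ : Submodule R R) = I := by simp
    rw [← hI, ← Submodule.Quotient.mk_eq_zero]
    refine hreg.right_eq_zero_of_smul ?_
    rw [← Submodule.Quotient.mk_smul, Submodule.Quotient.mk_eq_zero, hI]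
    simpa using hmem i
  ext m
  rw [← hg, LinearMap.zero_apply, Submodule.Quotient.mk_eq_zero]
  have hle : (I • ⊤ : Submodule R (M →ₗ[R] M)) ≤
      (I • ⊤ : Submodule R M).comap (LinearMap.applyₗ m) :=
    Submodule.smul_le.2 fun r hr n _ ↦ Submodule.smul_mem_smul hr trivial
  exact hle hmem'

variable [IsNoetherianRing R] [Module.Finite R M]

lemma exists_residueField_hom_ne_zero [Nontrivial M] :
    ∃ f : M →ₗ[R] (R ⧸ maximalIdeal R), f ≠ 0 := by
  by_contra! hf
  have : Subsingleton (M →ₗ[R] (R ⧸ maximalIdeal R)) := subsingleton_of_forall_eq 0 hf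
  obtain ⟨r, hr, hreg⟩ := IsSMulRegular.subsingleton_linearMap_iff.1 this
  have hru : IsUnit r := by
    by_contra hru
    refine one_ne_zero (α := R ⧸ maximalIdeal R) (hreg.right_eq_zero_of_smul ?_)
    rw [Algebra.smul_def, mul_one]
    exact Ideal.Quotient.eq_zero_iff_mem.2 hru
  obtain ⟨m, hm⟩ := exists_ne (0 : M)
  exact hm (hru.smul_eq_zero.1 (Module.mem_annihilator.1 hr m))

lemma EndReduction.exists_isSMulRegular [Nontrivial M] [Module.Free R (M →ₗ[R] M)]
    {d s : ℕ} {I : Ideal R} (h : EndReduction M d s I) (hI : I ≤ maximalIdeal R)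
    (hk : Subsingleton ((R ⧸ maximalIdeal R) →ₗ[R] ModIdeal R I)) :
    s < d ∧ ∃ x ∈ maximalIdeal R,
      IsSMulRegular (ModIdeal R I) x ∧ IsSMulRegular (ModIdeal M I) x := by
  obtain ⟨x, hx, hreg⟩ := IsSMulRegular.subsingleton_linearMap_iff.1 hk
  rw [Ideal.annihilator_quotient] at hx
  have hsd := h.lt_of_isSMulRegular hI hx hreg
  refine ⟨hsd, ?_⟩
  have hkM : Subsingleton ((R ⧸ maximalIdeal R) →ₗ[R] ModIdeal M I) := by
    refine subsingleton_of_forall_eq 0 fun φ ↦ ?_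
    obtain ⟨f, hf⟩ := exists_residueField_hom_ne_zero (R := R) (M := M)
    have : IsSimpleModule R (R ⧸ maximalIdeal R) :=
      isSimpleModule_iff_isCoatom.2 (maximalIdeal.isMaximal R).out
    have hfs : Function.Surjective f := LinearMap.surjective_of_ne_zero hf
    -- The composite `M → k → M/IM` is killed by `x`, which acts injectively on `Hom(M, M/IM)`.
    have h0 : φ ∘ₗ f = 0 := by
      refine h.eq_zero_of_smul_eq_zero hsd hreg _ ?_
      ext m
      rw [LinearMap.smul_apply, LinearMap.comp_apply, ← map_smul]
      have : x • f m = 0 := by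
        refine Module.mem_annihilator.1 ?_ (f m)
        rwa [Ideal.annihilator_quotient]
      rw [this, map_zero, LinearMap.zero_apply]
    refine LinearMap.ext fun y ↦ ?_
    obtain ⟨m, rfl⟩ := hfs y
    exact LinearMap.congr_fun h0 m
  -- Passing to the product yields a single element regular on both factors.
  have hprod : Subsingleton ((R ⧸ maximalIdeal R) →ₗ[R] (ModIdeal R I × ModIdeal M I)) :=
    ((LinearMap.prodEquiv R).symm.toEquiv).subsingleton
  obtain ⟨y, hy, hreg⟩ := IsSMulRegular.subsingleton_linearMap_iff.1 hprod
  rw [Ideal.annihilator_quotient] at hy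
  exact ⟨y, hy, fun a b hab ↦ congrArg Prod.fst (hreg (a₁ := (a, 0)) (a₂ := (b, 0))
    (Prod.ext hab (by simp))), fun a b hab ↦ congrArg Prod.snd
      (hreg (a₁ := (0, a)) (a₂ := (0, b)) (Prod.ext (by simp) hab))⟩

lemma exists_regularIdeal_endReduction [Nontrivial M] [Module.Free R (M →ₗ[R] M)] {d : ℕ}
    (hd : ringKrullDim R ≤ d)
    (hExt : ∀ i, 0 < i → i < d → Subsingleton (Ext (ModuleCat.of R M) (ModuleCat.of R M) i)) :
    ∃ (s : ℕ) (I : Ideal R), RegularIdeal M s I ∧ EndReduction M d s I ∧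
      ∃ φ : (R ⧸ maximalIdeal R) →ₗ[R] ModIdeal R I, φ ≠ 0 := by
  suffices H : ∀ n s (I : Ideal R), d ≤ s + n → RegularIdeal M s I → EndReduction M d s I →
      ∃ (s : ℕ) (I : Ideal R), RegularIdeal M s I ∧ EndReduction M d s I ∧
      ∃ φ : (R ⧸ maximalIdeal R) →ₗ[R] ModIdeal R I, φ ≠ 0 from
    H d 0 ⊥ (by lia) .bot (endReduction_bot hd hExt)
  intro n
  induction n with
  | zero =>
    intro s I hs hI h
    refine ⟨s, I, hI, h, ?_⟩
    by_contra! hφ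
    have := (h.exists_isSMulRegular hI.le_maximalIdeal (subsingleton_of_forall_eq 0 hφ)).1
    lia
  | succ n ih =>
    intro s I hs hI h
    by_cases hφ : ∃ φ : (R ⧸ maximalIdeal R) →ₗ[R] ModIdeal R I, φ ≠ 0
    · exact ⟨s, I, hI, h, hφ⟩
    · push Not at hφ
      obtain ⟨hsd, x, hx, hreg, hregM⟩ :=
        h.exists_isSMulRegular hI.le_maximalIdeal (subsingleton_of_forall_eq 0 hφ)
      exact ih (s + 1) _ (by lia) (hI.sup hx hreg hregM) (h.sup hsd hreg hregM)

end Tower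

/-! ### The local case -/

section LocalCase

variable {R : Type u} [CommRing R] [IsLocalRing R] {M : Type u} [AddCommGroup M] [Module R M]

omit [IsLocalRing R] in
lemma EndReduction.mem_of_smul_mem {d s : ℕ} {I : Ideal R} (h : EndReduction M d s I)
    {ι : Type*} [Nonempty ι] (b : Module.Basis ι R (M →ₗ[R] M)) {r : R}
    (hr : ∀ m : M, r • m ∈ (I • ⊤ : Submodule R M)) : r ∈ I := by
  obtain ⟨i⟩ := ‹Nonempty ι›
  have hmem := (mem_ideal_smul_top_iff_repr b I _).1
    (h.mem_of_forall_mem (r • b i) fun m ↦ hr (b i m)) i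
  simpa using hmem

variable [IsNoetherianRing R] [Module.Finite R M]

omit [IsNoetherianRing R] [Module.Finite R M] in
-- Self-injectivity of `R/I`: vanishing of `Ext^(s+1)` on the cokernel of `f` makes restriction
-- surjective on `Ext^s(-, R)`, hence on `Hom(-, R/I)`.
lemma RegularIdeal.exists_retraction {X : Type u} [AddCommGroup X] [Module R X] {s : ℕ}
    {I : Ideal R} (h : RegularIdeal X s I)
    (hext : ∀ (C : Type u) [AddCommGroup C] [Module R C] [Module.Finite R C],
      Subsingleton (Ext (ModuleCat.of R C) (ModuleCat.of R R) (s + 1)))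
    {P : Type u} [AddCommGroup P] [Module R P] [Module.Finite R P]
    (hP : ∀ r ∈ I, ∀ z : P, r • z = 0) (f : ModIdeal R I →ₗ[R] P) (hf : Function.Injective f) :
    ∃ g : P →ₗ[R] ModIdeal R I, g ∘ₗ f = LinearMap.id := by
  have hQ : ∀ r ∈ I, ∀ z : ModIdeal R I, r • z = 0 := fun r hr z ↦
    hf (by rw [map_smul, map_zero, hP r hr])
  have hS := ModuleCat.shortComplex_shortExact (ModuleCat.shortComplexOfCompEqZero f f.range.mkQ
    f.exact_map_mkQ_range.linearMap_comp_eq_zero) f.exact_map_mkQ_range hf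
    (Submodule.mkQ_surjective _)
  obtain ⟨e', he'⟩ := (h.precomp_modIdeal_ring_surjective (P := ModuleCat.of R P)
    (P' := ModuleCat.of R (ModIdeal R I)) (ModuleCat.ofHom f) hP hQ 0
    (fun i hi ↦ h.ext_ring_subsingleton_of_lt hQ i (by simpa using hi)) (fun e ↦
      Ext.contravariant_sequence_exact₁ hS _ e (n₁ := s + 1) (by lia)
        ((hext (P ⧸ f.range)).elim _ _))).2 (Ext.mk₀ (𝟙 _))
  obtain ⟨g, rfl⟩ := (Ext.mk₀_bijective _ _).2 e'
  rw [Ext.mk₀_comp_mk₀] at he'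
  exact ⟨g.hom, congrArg ModuleCat.Hom.hom ((Ext.mk₀_bijective _ _).1 he')⟩

lemma exists_surjective_to_ring [Nontrivial M] [Module.Free R (M →ₗ[R] M)] {n d : ℕ}
    (hn : HasInjectiveDimensionLE (ModuleCat.of R R) n) (hd : ringKrullDim R ≤ d)
    (hExt : ∀ i, 0 < i → i < d → Subsingleton (Ext (ModuleCat.of R M) (ModuleCat.of R M) i)) :
    ∃ f : M →ₗ[R] R, Function.Surjective f := by
  obtain ⟨s, I, hI, h, φ, hφ⟩ := exists_regularIdeal_endReduction hd hExt
  have hvan := fun i hi (C : Type u) [AddCommGroup C] [Module R C] [Module.Finite R C] ↦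
    ext_subsingleton_of_lt_of_residueField_hom hI φ hφ (ModuleCat.of R R) n hn i hi C
  have hM := hI.ext_subsingleton_of_modIdeal_module (ModuleCat.of R R)
    fun i hi ↦ hvan i hi (ModIdeal M I)
  obtain ⟨k, m, hm⟩ := Module.Finite.exists_fin (R := R) (M := M)
  let b := Module.Free.chooseBasis R (M →ₗ[R] M)
  have : Nonempty (Module.Free.ChooseBasisIndex R (M →ₗ[R] M)) := b.index_nonempty
  -- Scalars act on the generators `m j` modulo `I`; faithfulness of `M/IM` makes the kernel exactly
  -- `I`.
  let F : R →ₗ[R] (Fin k → ModIdeal M I) :=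
    LinearMap.pi fun j ↦ Submodule.mkQ _ ∘ₗ LinearMap.toSpanSingleton R M (m j)
  have hF : ∀ r j, F r j = Submodule.Quotient.mk (r • m j) := fun r j ↦ rfl
  have hker : F.ker = (I • ⊤ : Submodule R R) := by
    ext r
    rw [LinearMap.mem_ker, smul_eq_mul, Ideal.mul_top]
    constructor
    · intro hr
      refine h.mem_of_smul_mem b fun x ↦ ?_
      have hle : (⊤ : Submodule R M) ≤ (I • ⊤ : Submodule R M).comap (LinearMap.lsmul R M r) := by
        refine hm.ge.trans (Submodule.span_le.2 ?_)
        rintro _ ⟨j, rfl⟩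
        exact (Submodule.Quotient.mk_eq_zero (I • ⊤ : Submodule R M)).1 (congrFun hr j)
      exact hle trivial
    · intro hr
      ext j
      exact (Submodule.Quotient.mk_eq_zero _).2 (Submodule.smul_mem_smul hr trivial)
  let f : ModIdeal R I →ₗ[R] (Fin k → ModIdeal M I) := Submodule.liftQ _ F hker.ge
  obtain ⟨g, hg⟩ := hI.exists_retraction (hvan (s + 1) (by lia)) (fun r hr z ↦ by
    ext j
    obtain ⟨y, hy⟩ := Submodule.mkQ_surjective _ (z j)
    rw [Pi.smul_apply, ← hy, ← map_smul]
    exact (Submodule.Quotient.mk_eq_zero _).2 (Submodule.smul_mem_smul hr trivial)) f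
    (LinearMap.ker_eq_bot.1 (Submodule.ker_liftQ_eq_bot _ _ _ hker.le))
  choose G hG using fun j ↦ hI.exists_lift_to_ring hM
    (g ∘ₗ LinearMap.single R (fun _ ↦ ModIdeal M I) j ∘ₗ Submodule.mkQ _)
  have hsum : 1 - ∑ j, G j (m j) ∈ I := by
    have : (I • ⊤ : Submodule R R) = I := by simp
    rw [← this, ← Submodule.Quotient.mk_eq_zero, Submodule.Quotient.mk_sub, sub_eq_zero]
    have h1 : g (F 1) = Submodule.Quotient.mk 1 :=
      LinearMap.congr_fun hg (Submodule.Quotient.mk 1)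
    rw [← h1, ← Submodule.mkQ_apply, map_sum, ← Finset.univ_sum_single (F 1), map_sum]
    refine Finset.sum_congr rfl fun j _ ↦ ?_
    rw [Submodule.mkQ_apply, hG, hF, one_smul]
    rfl
  -- The sum is `1` modulo the maximal ideal, so not every term is a nonunit.
  have hex : ∃ j, IsUnit (G j (m j)) := by
    by_contra! hall
    refine (maximalIdeal.isMaximal R).ne_top ((Ideal.eq_top_iff_one _).2 ?_)
    rw [← sub_add_cancel 1 (∑ j, G j (m j))]
    exact add_mem (hI.le_maximalIdeal hsum) (sum_mem fun j _ ↦ hall j)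
  obtain ⟨j, u, hu⟩ := hex
  refine ⟨G j, fun r ↦ ⟨(r * ↑u⁻¹) • m j, ?_⟩⟩
  rw [map_smul, ← hu, smul_eq_mul, mul_assoc, Units.inv_mul, mul_one]

/-- Write `M = R ⊕ K`. Then `K` inherits the hypotheses as a retract, and `R × End(K)` embeds in
`End(M)`, so the rank of the endomorphism module drops. -/
lemma projective_of_projective_end_of_isLocalRing {n d : ℕ}
    (hn : HasInjectiveDimensionLE (ModuleCat.of R R) n) (hd : ringKrullDim R ≤ d)
    (hExt : ∀ i, 0 < i → i < d → Subsingleton (Ext (ModuleCat.of R M) (ModuleCat.of R M) i))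
    (hHom : Module.Projective R (M →ₗ[R] M)) : Module.Projective R M := by
  induction hk : Module.finrank R (M →ₗ[R] M) using Nat.strong_induction_on generalizing M with
  | _ k ih =>
    rcases subsingleton_or_nontrivial M with hM | hM
    · infer_instance
    have : Module.Free R (M →ₗ[R] M) := Module.free_of_flat_of_isLocalRing
    obtain ⟨f, hf⟩ := exists_surjective_to_ring hn hd hExt
    obtain ⟨m₀, hm₀⟩ := hf 1
    let σ : R →ₗ[R] M := LinearMap.toSpanSingleton R M m₀
    have hfσ : ∀ r, f (σ r) = r := fun r ↦ by simp [σ, hm₀]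
    let i : f.ker →ₗ[R] M := f.ker.subtype
    let p : M →ₗ[R] f.ker := (LinearMap.id - σ ∘ₗ f).codRestrict _ fun x ↦ by simp [hfσ]
    have hfi : ∀ x, f (i x) = 0 := fun x ↦ x.2
    have hpi : p ∘ₗ i = LinearMap.id := by
      ext x
      simp [p, i]
    have hpσ : ∀ r, p (σ r) = 0 := fun r ↦ by
      ext
      simp [p, hfσ]
    have hproj : Module.Projective R (f.ker →ₗ[R] f.ker) := by
      refine Module.Projective.of_split (M := M →ₗ[R] M)
        (LinearMap.lcomp R M p ∘ₗ LinearMap.compRight R i)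
        (LinearMap.lcomp R f.ker i ∘ₗ LinearMap.compRight R p) ?_
      ext g x
      have := LinearMap.congr_fun hpi
      simp only [LinearMap.comp_apply, LinearMap.id_apply] at this
      simp [this]
    have hfree : Module.Free R (f.ker →ₗ[R] f.ker) := Module.free_of_flat_of_isLocalRing
    have hlt : Module.finrank R (f.ker →ₗ[R] f.ker) < k := by
      let Φ : (R × (f.ker →ₗ[R] f.ker)) →ₗ[R] (M →ₗ[R] M) :=
        LinearMap.coprod (LinearMap.toSpanSingleton R _ (σ ∘ₗ f))
          (LinearMap.lcomp R M p ∘ₗ LinearMap.compRight R i)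
      have hΦ : ∀ r g x, Φ (r, g) x = r • σ (f x) + i (g (p x)) := fun _ _ _ ↦ rfl
      have hinj : Function.Injective Φ := by
        rw [injective_iff_map_eq_zero]
        rintro ⟨r, g⟩ hrg
        have hx : ∀ x, r • σ (f x) + i (g (p x)) = 0 := fun x ↦ by
          rw [← hΦ, hrg, LinearMap.zero_apply]
        have hr : r = 0 := by
          have := congrArg f (hx m₀)
          simpa [hfi, hfσ, hm₀] using this
        refine Prod.ext hr (LinearMap.ext fun y ↦ ?_)
        have := hx (i y)
        rw [hfi, map_zero, smul_zero, zero_add, ← LinearMap.comp_apply p i, hpi] at this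
        exact Subtype.ext this
      have := LinearMap.finrank_le_finrank_of_injective hinj
      rw [Module.finrank_prod, Module.finrank_self] at this
      lia
    have hK : Module.Projective R f.ker := ih _ hlt (fun j hj hjd ↦
      ext_subsingleton_of_retract (ModuleCat.ofHom i) (ModuleCat.ofHom p) (ModuleCat.ofHom i)
        (ModuleCat.ofHom p) (ModuleCat.hom_ext hpi) (ModuleCat.hom_ext hpi) j (hExt j hj hjd))
      hproj rfl
    refine Module.Projective.of_split (f.prod p) (LinearMap.coprod σ i) ?_
    ext x
    simp [p, i]

end LocalCase

/-! ### Localization of Ext and the global theorem -/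

section Localization

variable {R : Type u} [CommRing R]

lemma projective_localizedModule (S : Submonoid R) (X : ModuleCat.{u} R) [Module.Projective R X] :
    Module.Projective (Localization S) (X.localizedModule S) :=
  Module.projective_of_isLocalizedModule S (X.localizedModuleMkLinearMap S)

lemma finite_localizedModule (S : Submonoid R) (X : ModuleCat.{u} R) [Module.Finite R X] :
    Module.Finite (Localization S) (X.localizedModule S) :=
  Module.Finite.of_isLocalizedModule S (X.localizedModuleMkLinearMap S)

lemma projective_end_localizedModule (S : Submonoid R) (X : ModuleCat.{u} R)
    [Module.FinitePresentation R X] [Module.Projective R (X →ₗ[R] X)] :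
    Module.Projective (Localization S) (X.localizedModule S →ₗ[Localization S] X.localizedModule S) :=
  Module.projective_of_isLocalizedModule S (IsLocalizedModule.mapExtendScalars S
    (X.localizedModuleMkLinearMap S) (X.localizedModuleMkLinearMap S) (Localization S))

lemma projective_of_projective_localizedModule (X : ModuleCat.{u} R)
    [Module.FinitePresentation R X]
    (h : ∀ (p : Ideal R) [p.IsMaximal],
      Module.Projective (Localization.AtPrime p) (X.localizedModule p.primeCompl)) :
    Module.Projective R X :=
  Module.projective_of_localization_maximal' (fun p _ ↦ Localization.AtPrime p)
    (fun p _ ↦ X.localizedModule p.primeCompl)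
    (fun p _ ↦ X.localizedModuleMkLinearMap p.primeCompl) fun p _ ↦ h p

/-- Clearing denominators: degree zero is localization of Hom for finitely presented modules, and
higher degrees shift down along a finite free cover, which stays projective after localizing. -/
lemma exists_smul_eq_mapExactFunctor [IsNoetherianRing R] (S : Submonoid R) (n : ℕ)
    (X Y : ModuleCat.{u} R) [Module.Finite R X]
    (y : Ext ((ModuleCat.localizedModuleFunctor S).obj X)
      ((ModuleCat.localizedModuleFunctor S).obj Y) n) :
    ∃ (s : S) (e : Ext X Y n),
      algebraMap R (Localization S) s • y = e.mapExactFunctor (ModuleCat.localizedModuleFunctor S) := by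
  induction n generalizing X with
  | zero =>
    obtain ⟨g, rfl⟩ := (Ext.mk₀_bijective _ _).2 y
    have : Module.FinitePresentation R X := Module.finitePresentation_of_finite R X
    obtain ⟨⟨h, s⟩, hs⟩ := IsLocalizedModule.surj S (IsLocalizedModule.mapExtendScalars S
      (X.localizedModuleMkLinearMap S) (Y.localizedModuleMkLinearMap S) (Localization S)) g.hom
    refine ⟨s, Ext.mk₀ (ModuleCat.ofHom h), ?_⟩
    rw [Ext.mapExactFunctor_mk₀, ← Ext.mk₀_smul]
    congr 1
    refine ModuleCat.hom_ext ?_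
    refine LinearMap.ext fun x ↦ ?_
    exact (algebraMap_smul (M := Y.localizedModule S) (Localization S) (s : R) (g.hom x)).trans
      (LinearMap.congr_fun hs x)
  | succ n ih =>
    obtain ⟨N, _, _, _, _, f, hf⟩ := Module.exists_finite_presentation R X
    have hS := LinearMap.shortExact_shortComplexKer hf
    have hSp := hS.map_of_exact (ModuleCat.localizedModuleFunctor S)
    have : Projective ((ModuleCat.localizedModuleFunctor S).obj (ModuleCat.of R N)) :=
      (IsProjective.iff_projective _).1 (projective_localizedModule S (ModuleCat.of R N))
    obtain ⟨y₀, rfl⟩ := Ext.contravariant_sequence_exact₃ hSp _ y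
      (Ext.eq_zero_of_projective (P := (ModuleCat.localizedModuleFunctor S).obj (ModuleCat.of R N))
        _) (add_comm 1 n)
    obtain ⟨s, e, he⟩ := ih (ModuleCat.of R f.ker) y₀
    refine ⟨s, hS.extClass.comp e (add_comm 1 n), ?_⟩
    rw [Ext.mapExactFunctor_comp, Ext.mapExactFunctor_extClass]
    refine (Ext.comp_smul hSp.extClass y₀ (add_comm 1 n) _).symm.trans ?_
    exact congrArg (fun t ↦ hSp.extClass.comp t (add_comm 1 n)) he

lemma ext_subsingleton_localizedModule [IsNoetherianRing R] (S : Submonoid R) (n : ℕ)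
    (X Y : ModuleCat.{u} R) [Module.Finite R X] (h : Subsingleton (Ext X Y n)) :
    Subsingleton (Ext (X.localizedModule S) (Y.localizedModule S) n) :=
  subsingleton_of_forall_eq 0 fun y ↦ by
    obtain ⟨s, e, he⟩ := exists_smul_eq_mapExactFunctor S n X Y y
    rw [Subsingleton.elim e 0, Ext.mapExactFunctor_zero] at he
    exact (IsLocalization.map_units (Localization S) s).smul_eq_zero.1 he

end Localization

theorem mainTheorem7 (R : Type u) [CommRing R] (hR : IsGorensteinRing R)
    (d : ℕ) (hd : ringKrullDim R = (d : WithBot ℕ∞))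
    (M : Type u) [AddCommGroup M] [Module R M] [Module.Finite R M]
    (hExt : ∀ i : ℕ, 0 < i → i < d →
      Subsingleton (CategoryTheory.Abelian.Ext (ModuleCat.of R M) (ModuleCat.of R M) i))
    (hHom : Module.Projective R (M →ₗ[R] M)) :
    Module.Projective R M := by
  have := hR.isNoetherianRing
  let X := ModuleCat.of R M
  have : Module.FinitePresentation R X := Module.finitePresentation_of_finite R M
  have : Module.Projective R (X →ₗ[R] X) := hHom
  refine projective_of_projective_localizedModule X fun p hp ↦ ?_
  obtain ⟨n, hn⟩ := (hR.isGorensteinLocalRing_localization p).finite_injectiveDimension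
  have := finite_localizedModule p.primeCompl X
  have : IsNoetherianRing (Localization.AtPrime p) :=
    IsLocalization.isNoetherianRing p.primeCompl _ inferInstance
  -- Localizing may lower the dimension, hence only an upper bound in the local case.
  have hdim : ringKrullDim (Localization.AtPrime p) ≤ d := by
    rw [IsLocalization.AtPrime.ringKrullDim_eq_height p, ← hd]
    exact Ideal.height_le_ringKrullDim_of_isPrime
  exact projective_of_projective_end_of_isLocalRing hn hdim
    (fun i hi hid ↦ ext_subsingleton_localizedModule p.primeCompl i X X (hExt i hi hid))
    (projective_end_localizedModule p.primeCompl X)
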